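/- Consider two point particles of masses $m_1,m_2$, $0<m_1\le m_2$, in $\mathbb R^2$, attracted by a fixed center at the origin with potential energies $-m_i/|x_i|$ and interacting with each other through a force of potential energy $V(|x_1-x_2|)$: $$m_i\ddot x_i=-\frac{m_i x_i}{|x_i|^3}-\nabla_{x_i}V(|x_1-x_2|),\qquad i=1,2,$$ where $V(r)=0$ for $r\ge D$ and $V(r)\ge -U$ for $r>0$, with $D>0$ and $U\ge 0$. The solutions considered live on a time interval $I$, keep $x_1,x_2\ne0$, and visit only relative positions at which $y\mapsto V(|y|)$ is differentiable. Let $\mu_i=m_i/(m_1+m_2)$. The osculating Keplerian orbit of particle $i$ has specific energy $E_i=\frac12|v_i|^2-\frac1{|x_i|}$, specific angular momentum $L_i=x_i\wedge v_i$ and eccentricity $e_i=\sqrt{1+2E_iL_i^2}$; here $v_i=\dot x_i$, and the orbit is called elliptic if $E_i<0$. The specific energy and angular momentum of the system are $$E=\mu_1E_1+\mu_2E_2+\frac{V(|x_1-x_2|)}{m_1+m_2},\qquad L=\mu_1L_1+\mu_2L_2 .$$ Let $$\sigma(\mu_1,\mu_2)=-\frac{(1-e^2)(\mu_1^2+\mu_2^2e)^2}{2\mu_2e^2},\qquad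 e=\tfrac14\Big(\sqrt{(\mu_1/\mu_2)^4+8(\mu_1/\mu_2)^2}-(\mu_1/\mu_2)^2\Big).$$ Theorem. Fix $m_1,m_2$ and real values $E,L$ with $EL^2<\sigma(\mu_1,\mu_2)$. There are constants $D_0,U_0>0$, $R$, $\Lambda$, $c_1<1$, $c_2<1$, depending only on $m_1,m_2,E,L$, such that, whenever $D\le D_0$ and $U\le U_0$, the following holds for every $V$ as above and every motion that at some instant $t_0\in I$ has specific energy $E$, specific angular momentum $L$ and both osculating orbits elliptic: 1. both osculating orbits are elliptic at all times $t\in I$, during the interaction too; 2. both particles stay in a bounded region for all $t\in I$; 3. if the particles come within distance $D$ of each other at least once in $I$, then for all $t\in I$ (hence in particular during every interaction) $|x_i|\le R$, $|L_i|\le\Lambda$ and $e_i\le c_i<1$, $i=1,2$. -/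

import Mathlib

/-- The Euclidean plane. -/
abbrev Plane : Type := EuclideanSpace ℝ (Fin 2)

/-- The eccentricity that enters the critical value `sigmaCrit`. -/
noncomputable def critEcc (μ₁ μ₂ : ℝ) : ℝ :=
  (Real.sqrt ((μ₁ / μ₂) ^ 4 + 8 * (μ₁ / μ₂) ^ 2) - (μ₁ / μ₂) ^ 2) / 4

/-- The critical value `σ(μ₁, μ₂)`, for mass fractions `0 < μ₁ ≤ μ₂` with `μ₁ + μ₂ = 1`. -/
noncomputable def sigmaCrit (μ₁ μ₂ : ℝ) : ℝ :=
  -((1 - critEcc μ₁ μ₂ ^ 2) * (μ₁ ^ 2 + μ₂ ^ 2 * critEcc μ₁ μ₂) ^ 2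
    / (2 * μ₂ * critEcc μ₁ μ₂ ^ 2))

/-- Specific energy of the osculating Keplerian orbit through position `x` with velocity `v`. -/
noncomputable def keplerEnergy (x v : Plane) : ℝ := ‖v‖ ^ 2 / 2 - 1 / ‖x‖

/-- Specific angular momentum of the osculating Keplerian orbit. -/
noncomputable def keplerAngMom (x v : Plane) : ℝ := x 0 * v 1 - x 1 * v 0

/-- Eccentricity of the osculating Keplerian orbit. -/
noncomputable def keplerEcc (x v : Plane) : ℝ :=
  Real.sqrt (1 + 2 * keplerEnergy x v * keplerAngMom x v ^ 2)

/-- Specific energy of the whole system: total energy, including the interaction energy,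
divided by the total mass. -/
noncomputable def systemEnergy (m₁ m₂ : ℝ) (V : ℝ → ℝ) (x₁ x₂ v₁ v₂ : Plane) : ℝ :=
  (m₁ * keplerEnergy x₁ v₁ + m₂ * keplerEnergy x₂ v₂ + V ‖x₁ - x₂‖) / (m₁ + m₂)

/-- Specific angular momentum of the whole system. -/
noncomputable def systemAngMom (m₁ m₂ : ℝ) (x₁ x₂ v₁ v₂ : Plane) : ℝ :=
  (m₁ * keplerAngMom x₁ v₁ + m₂ * keplerAngMom x₂ v₂) / (m₁ + m₂)

/-- `x₁, x₂` (with velocities `v₁, v₂`) solve Newton's equations on the time interval `I` for two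
point particles of masses `m₁, m₂`, each attracted by the fixed center at the origin with potential
energy `-mᵢ / ‖xᵢ‖`, and interacting through the potential energy `V ‖x₁ - x₂‖`.
The interaction potential has to be differentiable at the relative positions that are visited; in
particular, coincidence of the particles is admitted only if `y ↦ V ‖y‖` is differentiable at `0`.
At an endpoint of `I` that belongs to `I` the derivatives are one-sided. -/
structure IsMotion (m₁ m₂ : ℝ) (V : ℝ → ℝ) (I : Set ℝ) (x₁ x₂ v₁ v₂ : ℝ → Plane) : Prop where
  interval : I.OrdConnected
  ne_center₁ : ∀ t ∈ I, x₁ t ≠ 0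
  ne_center₂ : ∀ t ∈ I, x₂ t ≠ 0
  differentiableAt : ∀ t ∈ I, DifferentiableAt ℝ (fun y : Plane => V ‖y‖) (x₁ t - x₂ t)
  velocity₁ : ∀ t ∈ I, HasDerivWithinAt x₁ (v₁ t) I t
  velocity₂ : ∀ t ∈ I, HasDerivWithinAt x₂ (v₂ t) I t
  newton₁ : ∀ t ∈ I, HasDerivWithinAt v₁
    (-((1 / ‖x₁ t‖ ^ 3) • x₁ t)
      - (1 / m₁) • gradient (fun y : Plane => V ‖y‖) (x₁ t - x₂ t)) I t
  newton₂ : ∀ t ∈ I, HasDerivWithinAt v₂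
    (-((1 / ‖x₂ t‖ ^ 3) • x₂ t)
      + (1 / m₂) • gradient (fun y : Plane => V ‖y‖) (x₁ t - x₂ t)) I t

/-!
The static fact behind the theorem concerns two particles at the same point `x ≠ 0`, with mass
fractions `a ≤ b` and speeds equal to `s₁, s₂ ≤ 1` times the escape speed `√(2 / ‖x‖)`. Then
`-(a E₁ + b E₂) * L ^ 2 ≤ 2 * (a (1 - s₁²) + b (1 - s₂²)) * (a s₁ + b s₂)²`, independently of `‖x‖`.
If one of the orbits is parabolic (`s₁ = 1` or `s₂ = 1`), the right-hand side is at most `-σ`; the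
maximum is attained when it is the lighter particle that is parabolic. If one of the orbits is radial
(`Lᵢ = 0`), its term in the last factor drops out, and the bound is again at most `-σ`
(`sigmaCrit_le_of_degenerate`). So for `E * L ^ 2 < σ` no degenerate orbit is possible at a
coincidence.

The hypothesis `E * L ^ 2 < σ < 0` forces `E < 0` and `L ≠ 0`. Hence close particles on bound orbits
stay in a compact annulus, and by compactness there is an `ε > 0` such that, whenever the particles
are within `ε` of each other and the interaction energy is not too negative, `Eᵢ ≤ -ε` and
`|Lᵢ| ≥ ε` (`exists_uniform_margin`).

Along a motion the total energy and angular momentum are conserved, and `Eᵢ`, `Lᵢ` are locally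
constant while the particles are more than `D` apart. For `D ≤ ε / 2` the sets of times at which
both orbits are elliptic, or at which `Eᵢ ≤ -ε` and `|Lᵢ| ≥ ε`, are therefore open and closed in the
time interval (the latter once the former is the whole interval), and connectedness propagates these
properties from `t₀`, or from a time of interaction, to all times. Bounds on `Eᵢ` and `Lᵢ` then bound
the distances, the angular momenta and the eccentricities.
-/

open Filter Topology

/-! ### The critical value -/

theorem critEcc_pos {a b : ℝ} (ha : 0 < a) (hb : 0 < b) : 0 < critEcc a b := by
  have hk : 0 < a / b := div_pos ha hb
  have : (a / b) ^ 2 < Real.sqrt ((a / b) ^ 4 + 8 * (a / b) ^ 2) :=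
    Real.lt_sqrt_of_sq_lt (by nlinarith [pow_pos hk 2])
  unfold critEcc
  linarith

theorem critEcc_quadratic (a b : ℝ) :
    2 * critEcc a b ^ 2 + (a / b) ^ 2 * critEcc a b = (a / b) ^ 2 := by
  have h := Real.sq_sqrt (show 0 ≤ (a / b) ^ 4 + 8 * (a / b) ^ 2 by positivity)
  unfold critEcc
  nlinarith

/-- The eccentricity entering `sigmaCrit` is `(a / b) * w`, where `w` is the critical point of
`s ↦ (1 - s ^ 2) * (a + b * s) ^ 2`; the critical value is, up to a factor `-2 * b`, the value of
this function at `w`. -/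
theorem exists_sigmaCrit_eq {a b : ℝ} (ha : 0 < a) (hb : 0 < b) :
    ∃ w : ℝ, 0 < w ∧ 2 * b * w ^ 2 + a * w = b ∧
      sigmaCrit a b = -(2 * b * (1 - w ^ 2) * (a + b * w) ^ 2) := by
  have he := critEcc_pos ha hb
  have hq := critEcc_quadratic a b
  obtain ⟨w, hw⟩ : ∃ w, critEcc a b = a / b * w := ⟨critEcc a b / (a / b), by field_simp⟩
  have hk : 0 < a / b := div_pos ha hb
  have hw0 : 0 < w := by
    rw [hw] at he
    exact pos_of_mul_pos_right he hk.le
  have hq' : 2 * b * w ^ 2 + a * w = b := by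
    rw [hw] at hq
    field_simp at hq
    linarith
  refine ⟨w, hw0, hq', ?_⟩
  have h1 : 1 - (a / b * w) ^ 2 = 4 * w ^ 2 * (1 - w ^ 2) := by
    have : a / b * w = 1 - 2 * w ^ 2 := by
      field_simp
      linarith
    rw [this]
    ring
  unfold sigmaCrit
  rw [hw, h1]
  field_simp
  ring

/-- The bound when the lighter particle moves at escape speed and the heavier one at `s` times
escape speed: the point `w` of `exists_sigmaCrit_eq` is a global maximum. -/
theorem sigmaCrit_le_light {a b : ℝ} (ha : 0 < a) (hb : 0 < b) (s : ℝ) :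
    sigmaCrit a b ≤ -(2 * b * (1 - s ^ 2) * (a + b * s) ^ 2) := by
  obtain ⟨w, hw, hq, hσ⟩ := exists_sigmaCrit_eq ha hb
  rw [hσ]
  have haw : a * w = b * (1 - 2 * w ^ 2) := by linarith
  have hw2 : 0 < 1 - 2 * w ^ 2 := pos_of_mul_pos_right (haw ▸ mul_pos ha hw) hb.le
  -- Multiplying by `w ^ 2 / b ^ 2` eliminates `a`, because `a * w = b * (1 - 2 * w ^ 2)`.
  have key : (1 - s ^ 2) * (1 - 2 * w ^ 2 + w * s) ^ 2 ≤ (1 - w ^ 2) * (1 - w ^ 2) ^ 2 := by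
    have : (1 - w ^ 2) * (1 - w ^ 2) ^ 2 - (1 - s ^ 2) * (1 - 2 * w ^ 2 + w * s) ^ 2
        = (s - w) ^ 2 * ((1 + w * (s - w)) ^ 2 + w ^ 2 * (1 - 2 * w ^ 2)) := by ring
    have h2 : 0 ≤ (s - w) ^ 2 * ((1 + w * (s - w)) ^ 2 + w ^ 2 * (1 - 2 * w ^ 2)) := by
      positivity
    linarith
  have e1 : w ^ 2 * (a + b * s) ^ 2 = b ^ 2 * (1 - 2 * w ^ 2 + w * s) ^ 2 := by
    have : w * (a + b * s) = b * (1 - 2 * w ^ 2 + w * s) := by linarith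
    rw [← mul_pow, this, mul_pow]
  have e2 : w ^ 2 * (a + b * w) ^ 2 = b ^ 2 * (1 - w ^ 2) ^ 2 := by
    have : w * (a + b * w) = b * (1 - w ^ 2) := by linarith
    rw [← mul_pow, this, mul_pow]
  have : w ^ 2 * ((1 - s ^ 2) * (a + b * s) ^ 2) ≤ w ^ 2 * ((1 - w ^ 2) * (a + b * w) ^ 2) := by
    calc _ = b ^ 2 * ((1 - s ^ 2) * (1 - 2 * w ^ 2 + w * s) ^ 2) := by
          rw [mul_left_comm, e1]; ring
      _ ≤ b ^ 2 * ((1 - w ^ 2) * (1 - w ^ 2) ^ 2) := by gcongr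
      _ = _ := by rw [mul_left_comm (w ^ 2), e2]; ring
  have := le_of_mul_le_mul_left this (by positivity)
  nlinarith

/-- The bound when the heavier particle moves at escape speed and the lighter one at `s` times
escape speed. It follows from `sigmaCrit_le_light`: exchanging the masses while keeping `s` gives
a larger value if `s ≥ 1 / 3`, and smaller `s` are compared with the speed ratio `1 / 2`. -/
theorem sigmaCrit_le_heavy {a b : ℝ} (ha : 0 < a) (hab : a ≤ b) {s : ℝ} (hs : 0 ≤ s)
    (hs1 : s ≤ 1) :
    sigmaCrit a b ≤ -(2 * a * (1 - s ^ 2) * (b + a * s) ^ 2) := by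
  have hb : 0 < b := ha.trans_le hab
  have hs2 : 0 ≤ 1 - s ^ 2 := by nlinarith
  rcases le_total (1 / 3) s with h | h
  · refine (sigmaCrit_le_light ha hb s).trans ?_
    have : a * (b + a * s) ^ 2 ≤ b * (a + b * s) ^ 2 := by
      have h0 : 0 ≤ -(a * b) + 2 * (a * b) * s + (a ^ 2 + a * b + b ^ 2) * s ^ 2 := by
        nlinarith [mul_nonneg (sub_nonneg.2 h) (mul_pos ha hb).le,
          mul_nonneg (sq_nonneg (a - b)) (sq_nonneg s),
          mul_nonneg (mul_nonneg (sub_nonneg.2 h) (mul_pos ha hb).le) hs]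
      nlinarith [mul_nonneg (sub_nonneg.2 hab) h0]
    nlinarith [mul_le_mul_of_nonneg_left this hs2]
  · refine (sigmaCrit_le_light ha hb (1 / 2)).trans ?_
    have h1 : (1 - s ^ 2) * (b + a * s) ^ 2 ≤ b ^ 2 + 2 / 3 * a * b := by
      nlinarith [mul_nonneg (mul_pos ha hb).le (sub_nonneg.2 h), mul_nonneg hs (sq_nonneg s),
        mul_nonneg (sq_nonneg s) (mul_nonneg hb.le (sub_nonneg.2 hab)),
        mul_nonneg (sq_nonneg s) (mul_nonneg ha.le (sub_nonneg.2 hab)),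
        mul_nonneg (mul_nonneg hs (sq_nonneg s)) (mul_pos ha hb).le,
        mul_nonneg (mul_nonneg (sq_nonneg s) (sq_nonneg s)) (sq_nonneg a)]
    have h2 : a * (b ^ 2 + 2 / 3 * a * b) ≤ 3 / 4 * b * (a + b / 2) ^ 2 := by
      nlinarith [mul_nonneg hb.le (sq_nonneg (a - 3/2 * b)), mul_pos ha hb,
        mul_nonneg hb.le (sq_nonneg (a - b)), mul_nonneg (mul_pos ha hb).le (sub_nonneg.2 hab),
        mul_nonneg hb.le (mul_nonneg hb.le (sub_nonneg.2 hab))]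
    nlinarith [mul_le_mul_of_nonneg_left h1 ha.le]

/-- The value `-(b / 2)` is a lower bound of `E * L ^ 2` when one of the angular momenta vanishes
(see `sigmaCrit_le_of_degenerate`), so such configurations also lie above the critical value. -/
theorem sigmaCrit_le_neg_half {a b : ℝ} (ha : 0 < a) (hb : 0 < b) (hsum : a + b = 1) :
    sigmaCrit a b ≤ -(b / 2) := by
  have hr := Real.sq_sqrt (show (0 : ℝ) ≤ 1 / 2 by norm_num)
  have h0 := Real.sqrt_nonneg (1 / 2 : ℝ)
  have h1 : Real.sqrt (1 / 2) ≤ 1 := Real.sqrt_le_one.2 (by norm_num)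
  refine (sigmaCrit_le_light ha hb (Real.sqrt (1 / 2))).trans ?_
  have : Real.sqrt (1 / 2) ≤ a + b * Real.sqrt (1 / 2) := by nlinarith
  rw [hr]
  nlinarith [mul_le_mul_of_nonneg_left (pow_le_pow_left₀ h0 this 2) hb.le]

/-! ### Two particles at the same position -/

theorem keplerAngMom_sq_le (x v : Plane) : keplerAngMom x v ^ 2 ≤ (‖x‖ * ‖v‖) ^ 2 := by
  rw [mul_pow, EuclideanSpace.real_norm_sq_eq, EuclideanSpace.real_norm_sq_eq, Fin.sum_univ_two,
    Fin.sum_univ_two, keplerAngMom]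
  nlinarith [sq_nonneg (x 0 * v 0 + x 1 * v 1)]

theorem abs_keplerAngMom_le (x v : Plane) : |keplerAngMom x v| ≤ ‖x‖ * ‖v‖ :=
  abs_le_of_sq_le_sq (keplerAngMom_sq_le x v) (by positivity)

theorem norm_sq_mul_norm_le {x v : Plane} (hx : x ≠ 0) (h : keplerEnergy x v ≤ 0) :
    ‖v‖ ^ 2 * ‖x‖ ≤ 2 := by
  have hx' := norm_pos_iff.2 hx
  unfold keplerEnergy at h
  have : ‖v‖ ^ 2 ≤ 2 / ‖x‖ := by
    have : 2 / ‖x‖ = 2 * (1 / ‖x‖) := by ring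
    linarith
  rwa [le_div_iff₀ hx'] at this

theorem keplerEnergy_nonpos {x v : Plane} (hx : x ≠ 0) (h : ‖v‖ ^ 2 * ‖x‖ ≤ 2) :
    keplerEnergy x v ≤ 0 := by
  have hx' := norm_pos_iff.2 hx
  rw [← le_div_iff₀ hx'] at h
  unfold keplerEnergy
  have : 2 / ‖x‖ = 2 * (1 / ‖x‖) := by ring
  linarith

theorem neg_inv_norm_le_keplerEnergy (x v : Plane) : -(1 / ‖x‖) ≤ keplerEnergy x v := by
  unfold keplerEnergy
  nlinarith [sq_nonneg ‖v‖]

/-- Here `s` is the ratio of the speed `‖v‖` to the escape speed `√(2 / ‖x‖)`. -/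
theorem exists_speedRatio {x : Plane} (hx : x ≠ 0) (v : Plane) (h : keplerEnergy x v ≤ 0) :
    ∃ s : ℝ, 0 ≤ s ∧ s ≤ 1 ∧ keplerEnergy x v = -(1 - s ^ 2) / ‖x‖ ∧
      |keplerAngMom x v| ≤ Real.sqrt (2 * ‖x‖) * s := by
  have hx' := norm_pos_iff.2 hx
  have hr := Real.sq_sqrt (show 0 ≤ 2 * ‖x‖ by positivity)
  have hs2 : (‖v‖ * Real.sqrt (2 * ‖x‖) / 2) ^ 2 = ‖v‖ ^ 2 * ‖x‖ / 2 := by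
    rw [div_pow, mul_pow, hr]; ring
  refine ⟨‖v‖ * Real.sqrt (2 * ‖x‖) / 2, by positivity, ?_, ?_, ?_⟩
  · have := norm_sq_mul_norm_le hx h
    nlinarith [show 0 ≤ ‖v‖ * Real.sqrt (2 * ‖x‖) / 2 by positivity]
  · rw [hs2]
    unfold keplerEnergy
    field_simp
    ring
  · refine (abs_keplerAngMom_le x v).trans (le_of_eq ?_)
    linear_combination (-‖v‖ / 2) * hr

/-- `E * L ^ 2` in terms of the speed ratios `s₁`, `s₂`: the distance `r` to the center cancels. -/
theorem energy_mul_sq_ge {a b r K₁ K₂ L s₁ s₂ l : ℝ} (hr : 0 < r) (hK₁ : K₁ = -(1 - s₁ ^ 2) / r)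
    (hK₂ : K₂ = -(1 - s₂ ^ 2) / r) (hneg : a * K₁ + b * K₂ ≤ 0)
    (hL : |L| ≤ Real.sqrt (2 * r) * l) :
    -(2 * (a * (1 - s₁ ^ 2) + b * (1 - s₂ ^ 2)) * l ^ 2) ≤ (a * K₁ + b * K₂) * L ^ 2 := by
  have hL2 : L ^ 2 ≤ 2 * r * l ^ 2 := by
    have := pow_le_pow_left₀ (abs_nonneg L) hL 2
    rwa [sq_abs, mul_pow, Real.sq_sqrt (by positivity)] at this
  refine le_trans (le_of_eq ?_) (mul_le_mul_of_nonpos_left hL2 hneg)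
  rw [hK₁, hK₂]
  field_simp
  ring

/-- For two particles at the same position, on orbits that are elliptic or parabolic, `E * L ^ 2` is at
least the critical value as soon as one of the orbits is parabolic or radial. -/
theorem sigmaCrit_le_of_degenerate {a b : ℝ} (ha : 0 < a) (hab : a ≤ b) (hsum : a + b = 1)
    {x v₁ v₂ : Plane} (hx : x ≠ 0) (h₁ : keplerEnergy x v₁ ≤ 0) (h₂ : keplerEnergy x v₂ ≤ 0)
    (hdeg : keplerEnergy x v₁ = 0 ∨ keplerEnergy x v₂ = 0 ∨
      keplerAngMom x v₁ = 0 ∨ keplerAngMom x v₂ = 0) :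
    sigmaCrit a b ≤ (a * keplerEnergy x v₁ + b * keplerEnergy x v₂) *
      (a * keplerAngMom x v₁ + b * keplerAngMom x v₂) ^ 2 := by
  have hb : 0 < b := ha.trans_le hab
  have hx' := norm_pos_iff.2 hx
  obtain ⟨s₁, hs₁, hs₁', hK₁, hL₁⟩ := exists_speedRatio hx v₁ h₁
  obtain ⟨s₂, hs₂, hs₂', hK₂, hL₂⟩ := exists_speedRatio hx v₂ h₂
  have hneg : a * keplerEnergy x v₁ + b * keplerEnergy x v₂ ≤ 0 := by nlinarith
  have hL : |a * keplerAngMom x v₁ + b * keplerAngMom x v₂|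
      ≤ a * |keplerAngMom x v₁| + b * |keplerAngMom x v₂| := by
    refine (abs_add_le _ _).trans_eq ?_
    rw [abs_mul, abs_mul, abs_of_pos ha, abs_of_pos hb]
  have hA := mul_le_mul_of_nonneg_left hL₁ ha.le
  have hB := mul_le_mul_of_nonneg_left hL₂ hb.le
  have hq₁ : 0 ≤ s₁ ^ 2 := sq_nonneg _
  have hq₂ : 0 ≤ s₂ ^ 2 := sq_nonneg _
  rcases hdeg with h | h | h | h
  · have h1 : s₁ = 1 := by
      rw [h, eq_comm, div_eq_zero_iff] at hK₁
      rcases hK₁ with h | h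
      · nlinarith
      · exact absurd h hx'.ne'
    refine (sigmaCrit_le_light ha hb s₂).trans (le_trans (le_of_eq ?_)
      (energy_mul_sq_ge (l := a * s₁ + b * s₂) hx' hK₁ hK₂ hneg (by linarith)))
    rw [h1]; ring
  · have h1 : s₂ = 1 := by
      rw [h, eq_comm, div_eq_zero_iff] at hK₂
      rcases hK₂ with h | h
      · nlinarith
      · exact absurd h hx'.ne'
    refine (sigmaCrit_le_heavy ha hab hs₁ hs₁').trans (le_trans (le_of_eq ?_)
      (energy_mul_sq_ge (l := a * s₁ + b * s₂) hx' hK₁ hK₂ hneg (by linarith)))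
    rw [h1]; ring
  · rw [h, abs_zero] at hL
    refine (sigmaCrit_le_neg_half ha hb hsum).trans (le_trans ?_
      (energy_mul_sq_ge (l := b * s₂) hx' hK₁ hK₂ hneg (by rw [h]; linarith)))
    have : a * (1 - s₁ ^ 2) + b * (1 - s₂ ^ 2) ≤ 1 - b * s₂ ^ 2 := by nlinarith
    have := mul_le_mul_of_nonneg_right this (sq_nonneg (b * s₂))
    nlinarith [mul_nonneg hb.le (sq_nonneg (2 * b * s₂ ^ 2 - 1))]
  · rw [h, abs_zero] at hL
    refine (sigmaCrit_le_neg_half ha hb hsum).trans (le_trans ?_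
      (energy_mul_sq_ge (l := a * s₁) hx' hK₁ hK₂ hneg (by rw [h]; linarith)))
    have : a * (1 - s₁ ^ 2) + b * (1 - s₂ ^ 2) ≤ 1 - a * s₁ ^ 2 := by nlinarith
    have := mul_le_mul_of_nonneg_right this (sq_nonneg (a * s₁))
    nlinarith [mul_nonneg ha.le (sq_nonneg (2 * a * s₁ ^ 2 - 1))]

theorem sigmaCrit_neg {a b : ℝ} (ha : 0 < a) (hb : 0 < b) : sigmaCrit a b < 0 := by
  have := sigmaCrit_le_light ha hb 0
  have h : 0 < 2 * b * a ^ 2 := by positivity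
  nlinarith

/-! ### Uniform margins near a collision -/

/-- Two close particles on bound orbits stay away from the center, because the total angular momentum
is nonzero, and from infinity, because the total energy is negative. -/
theorem norm_bounds_of_close {a b E L η : ℝ} (ha : 0 < a) (hb : 0 < b) (hsum : a + b = 1)
    (hE : E < 0) (hη : η ≤ L ^ 2 / 4) {x₁ x₂ v₁ v₂ : Plane} (hx₁ : x₁ ≠ 0) (hx₂ : x₂ ≠ 0)
    (h₁ : keplerEnergy x₁ v₁ ≤ 0) (h₂ : keplerEnergy x₂ v₂ ≤ 0) (hd : ‖x₁ - x₂‖ ≤ η)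
    (hen : a * keplerEnergy x₁ v₁ + b * keplerEnergy x₂ v₂ ≤ E / 2)
    (hL : a * keplerAngMom x₁ v₁ + b * keplerAngMom x₂ v₂ = L) :
    (L ^ 2 / 4 ≤ ‖x₁‖ ∧ L ^ 2 / 4 ≤ ‖x₂‖) ∧
      ‖x₁‖ ≤ 2 / (-E) + L ^ 2 / 4 ∧ ‖x₂‖ ≤ 2 / (-E) + L ^ 2 / 4 := by
  have hp₁ := norm_pos_iff.2 hx₁
  have hp₂ := norm_pos_iff.2 hx₂
  have d₁ : ‖x₁‖ - ‖x₂‖ ≤ η := (norm_sub_norm_le _ _).trans hd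
  have d₂ : ‖x₂‖ - ‖x₁‖ ≤ η := (norm_sub_norm_le _ _).trans (norm_sub_rev x₁ x₂ ▸ hd)
  have l₁ : keplerAngMom x₁ v₁ ^ 2 ≤ 2 * ‖x₁‖ := by
    nlinarith [keplerAngMom_sq_le x₁ v₁, norm_sq_mul_norm_le hx₁ h₁]
  have l₂ : keplerAngMom x₂ v₂ ^ 2 ≤ 2 * ‖x₂‖ := by
    nlinarith [keplerAngMom_sq_le x₂ v₂, norm_sq_mul_norm_le hx₂ h₂]
  have hl : L ^ 2 ≤ a * (2 * ‖x₁‖) + b * (2 * ‖x₂‖) := by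
    have : L ^ 2 ≤ a * keplerAngMom x₁ v₁ ^ 2 + b * keplerAngMom x₂ v₂ ^ 2 := by
      obtain rfl : a = 1 - b := by linarith
      rw [← hL]
      nlinarith [mul_nonneg (mul_pos ha hb).le
        (sq_nonneg (keplerAngMom x₁ v₁ - keplerAngMom x₂ v₂))]
    nlinarith
  have hi : -E / 2 ≤ a * (1 / ‖x₁‖) + b * (1 / ‖x₂‖) := by
    nlinarith [neg_inv_norm_le_keplerEnergy x₁ v₁, neg_inv_norm_le_keplerEnergy x₂ v₂]
  have key : ‖x₁‖ ≤ 2 / (-E) ∨ ‖x₂‖ ≤ 2 / (-E) := by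
    by_contra! hc
    have hpos : 0 < 2 / (-E) := div_pos two_pos (by linarith)
    have i₁ := one_div_lt_one_div_of_lt hpos hc.1
    have i₂ := one_div_lt_one_div_of_lt hpos hc.2
    rw [one_div_div] at i₁ i₂
    nlinarith
  refine ⟨⟨by nlinarith, by nlinarith⟩, ?_⟩
  rcases key with h | h <;> constructor <;> nlinarith [sq_nonneg L]

theorem continuous_keplerAngMom {X : Type*} [TopologicalSpace X] {f g : X → Plane}
    (hf : Continuous f) (hg : Continuous g) : Continuous fun p => keplerAngMom (f p) (g p) := by
  unfold keplerAngMom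
  fun_prop

theorem ContinuousOn.keplerEnergy {X : Type*} [TopologicalSpace X] {s : Set X} {f g : X → Plane}
    (hf : ContinuousOn f s) (hg : ContinuousOn g s) (h0 : ∀ p ∈ s, f p ≠ 0) :
    ContinuousOn (fun p => keplerEnergy (f p) (g p)) s := by
  unfold _root_.keplerEnergy
  exact ((hg.norm.pow 2).div_const 2).sub
    (continuousOn_const.div hf.norm fun p hp => norm_ne_zero_iff.2 (h0 p hp))

/-- Positions and velocities `((x₁, x₂), (v₁, v₂))` with distances to the center in `[ℓ, R]`, total
angular momentum `L` and Kepler energies at most zero. The energy conditions are multiplied by the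
distances, so that the set is visibly closed. -/
def boundConfigurations (a b L ℓ R : ℝ) : Set ((Plane × Plane) × Plane × Plane) :=
  {p | (ℓ ≤ ‖p.1.1‖ ∧ ‖p.1.1‖ ≤ R) ∧ (ℓ ≤ ‖p.1.2‖ ∧ ‖p.1.2‖ ≤ R) ∧
    ‖p.2.1‖ ^ 2 * ‖p.1.1‖ ≤ 2 ∧ ‖p.2.2‖ ^ 2 * ‖p.1.2‖ ≤ 2 ∧
    a * keplerAngMom p.1.1 p.2.1 + b * keplerAngMom p.1.2 p.2.2 = L}

theorem isCompact_boundConfigurations (a b L : ℝ) {ℓ : ℝ} (hℓ : 0 < ℓ) (R : ℝ) :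
    IsCompact (boundConfigurations a b L ℓ R) := by
  refine Metric.isCompact_of_isClosed_isBounded ?_ ?_
  · have c₁ : Continuous fun p : (Plane × Plane) × Plane × Plane => keplerAngMom p.1.1 p.2.1 :=
      continuous_keplerAngMom (by fun_prop) (by fun_prop)
    have c₂ : Continuous fun p : (Plane × Plane) × Plane × Plane => keplerAngMom p.1.2 p.2.2 :=
      continuous_keplerAngMom (by fun_prop) (by fun_prop)
    simp only [boundConfigurations, Set.ofPred_and]
    refine ((isClosed_le ?_ ?_).inter (isClosed_le ?_ ?_)).inter
      (((isClosed_le ?_ ?_).inter (isClosed_le ?_ ?_)).inter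
        ((isClosed_le ?_ ?_).inter ((isClosed_le ?_ ?_).inter (isClosed_eq ?_ ?_)))) <;> fun_prop
  · have hv : ∀ {x v : Plane}, ℓ ≤ ‖x‖ → ‖v‖ ^ 2 * ‖x‖ ≤ 2 → ‖v‖ ≤ 2 / ℓ + 1 := by
      intro x v hx h
      have h1 : ‖v‖ ^ 2 ≤ 2 / ℓ := by
        rw [le_div_iff₀ hℓ]
        exact (mul_le_mul_of_nonneg_left hx (sq_nonneg _)).trans h
      nlinarith [sq_nonneg (‖v‖ - 1)]
    refine (Metric.isBounded_closedBall (x := (0 : (Plane × Plane) × Plane × Plane))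
      (r := max R (2 / ℓ + 1))).subset fun p hp => ?_
    obtain ⟨⟨h1, h2⟩, ⟨h3, h4⟩, h5, h6, -⟩ := hp
    rw [mem_closedBall_zero_iff, Prod.norm_def, Prod.norm_def, Prod.norm_def]
    exact max_le (max_le (h2.trans (le_max_left _ _)) (h4.trans (le_max_left _ _)))
      (max_le ((hv h1 h5).trans (le_max_right _ _)) ((hv h3 h6).trans (le_max_right _ _)))

/-- The quantitative form of `sigmaCrit_le_of_degenerate`, by compactness: if the particles are close,
both orbits keep a uniform distance from being parabolic or radial. -/
theorem exists_uniform_margin {a b E L : ℝ} (ha : 0 < a) (hab : a ≤ b) (hsum : a + b = 1)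
    (hEL : E * L ^ 2 < sigmaCrit a b) :
    ∃ ε > 0, ∀ x₁ x₂ v₁ v₂ : Plane, x₁ ≠ 0 → x₂ ≠ 0 →
      keplerEnergy x₁ v₁ ≤ 0 → keplerEnergy x₂ v₂ ≤ 0 → ‖x₁ - x₂‖ ≤ ε →
      a * keplerEnergy x₁ v₁ + b * keplerEnergy x₂ v₂ ≤ E + ε →
      a * keplerAngMom x₁ v₁ + b * keplerAngMom x₂ v₂ = L →
      (keplerEnergy x₁ v₁ ≤ -ε ∧ keplerEnergy x₂ v₂ ≤ -ε) ∧
        ε ≤ |keplerAngMom x₁ v₁| ∧ ε ≤ |keplerAngMom x₂ v₂| := by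
  have hb : 0 < b := ha.trans_le hab
  have hneg : E * L ^ 2 < 0 := hEL.trans (sigmaCrit_neg ha hb)
  have hE : E < 0 := by
    by_contra! h
    exact absurd hneg (not_lt.2 (by positivity))
  have hL : L ≠ 0 := by
    rintro rfl
    simp at hneg
  have hℓ : 0 < L ^ 2 / 4 := by positivity
  have hne : ∀ {x : Plane}, L ^ 2 / 4 ≤ ‖x‖ → x ≠ 0 := fun h => norm_pos_iff.1 (hℓ.trans_le h)
  set K := boundConfigurations a b L (L ^ 2 / 4) (2 / (-E) + L ^ 2 / 4) with hK
  -- `G ≤ 0` would mean coincident particles, total energy at most `E` and a degenerate orbit.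
  let G : (Plane × Plane) × Plane × Plane → ℝ := fun p =>
    max (max ‖p.1.1 - p.1.2‖
        (a * keplerEnergy p.1.1 p.2.1 + b * keplerEnergy p.1.2 p.2.2 - E))
      (min (min (-keplerEnergy p.1.1 p.2.1) (-keplerEnergy p.1.2 p.2.2))
        (min |keplerAngMom p.1.1 p.2.1| |keplerAngMom p.1.2 p.2.2|))
  have hG : ContinuousOn G K := by
    have e₁ : ContinuousOn (fun p : (Plane × Plane) × Plane × Plane =>
        keplerEnergy p.1.1 p.2.1) K :=
      ContinuousOn.keplerEnergy (by fun_prop) (by fun_prop) fun p hp => hne hp.1.1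
    have e₂ : ContinuousOn (fun p : (Plane × Plane) × Plane × Plane =>
        keplerEnergy p.1.2 p.2.2) K :=
      ContinuousOn.keplerEnergy (by fun_prop) (by fun_prop) fun p hp => hne hp.2.1.1
    have l₁ : ContinuousOn (fun p : (Plane × Plane) × Plane × Plane =>
        keplerAngMom p.1.1 p.2.1) K :=
      (continuous_keplerAngMom (by fun_prop) (by fun_prop)).continuousOn
    have l₂ : ContinuousOn (fun p : (Plane × Plane) × Plane × Plane =>
        keplerAngMom p.1.2 p.2.2) K :=
      (continuous_keplerAngMom (by fun_prop) (by fun_prop)).continuousOn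
    fun_prop
  have hpos : ∀ p ∈ K, 0 < G p := by
    rintro ⟨⟨x₁, x₂⟩, v₁, v₂⟩ ⟨⟨h1, -⟩, ⟨h3, -⟩, h5, h6, h7⟩
    by_contra! hc
    simp only [G, max_le_iff, min_le_iff, norm_le_zero_iff, sub_eq_zero] at hc
    dsimp only at h1 h3 h5 h6 h7
    obtain ⟨⟨rfl, hen⟩, hdeg⟩ := hc
    have k₁ := keplerEnergy_nonpos (hne h1) h5
    have k₂ := keplerEnergy_nonpos (hne h1) h6
    have := sigmaCrit_le_of_degenerate ha hab hsum (hne h1) k₁ k₂ (by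
      rcases hdeg with (h | h) | h | h
      · exact Or.inl (by linarith)
      · exact Or.inr (Or.inl (by linarith))
      · exact Or.inr (Or.inr (Or.inl (abs_nonpos_iff.1 h)))
      · exact Or.inr (Or.inr (Or.inr (abs_nonpos_iff.1 h))))
    rw [h7] at this
    nlinarith [sq_nonneg L]
  obtain ⟨δ, hδ, hδG⟩ :=
    (isCompact_boundConfigurations a b L hℓ _).exists_forall_le' hG hpos
  refine ⟨min (δ / 2) (min (L ^ 2 / 4) (-E / 2)),
    lt_min (by linarith) (lt_min hℓ (by linarith)), ?_⟩
  intro x₁ x₂ v₁ v₂ hx₁ hx₂ k₁ k₂ hd hen hl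
  set ε := min (δ / 2) (min (L ^ 2 / 4) (-E / 2))
  have ε1 : ε ≤ δ / 2 := min_le_left _ _
  have ε2 : ε ≤ L ^ 2 / 4 := (min_le_right _ _).trans (min_le_left _ _)
  have ε3 : ε ≤ -E / 2 := (min_le_right _ _).trans (min_le_right _ _)
  obtain ⟨⟨b1, b2⟩, b3, b4⟩ :=
    norm_bounds_of_close ha hb hsum hE ε2 hx₁ hx₂ k₁ k₂ hd (by linarith) hl
  have hGp := hδG ((x₁, x₂), v₁, v₂) ⟨⟨b1, b3⟩, ⟨b2, b4⟩, norm_sq_mul_norm_le hx₁ k₁,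
    norm_sq_mul_norm_le hx₂ k₂, hl⟩
  simp only [G, le_max_iff, le_min_iff] at hGp
  rcases hGp with (h | h) | ⟨⟨g1, g2⟩, g3, g4⟩
  · linarith
  · linarith
  · exact ⟨⟨by linarith, by linarith⟩, by linarith, by linarith⟩

/-! ### Conservation laws -/

theorem hasDerivWithinAt_keplerEnergy {x v : ℝ → Plane} {f : Plane} {I : Set ℝ} {t : ℝ}
    (h0 : x t ≠ 0) (hx : HasDerivWithinAt x (v t) I t)
    (hv : HasDerivWithinAt v (-((1 / ‖x t‖ ^ 3) • x t) + f) I t) :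
    HasDerivWithinAt (fun s => keplerEnergy (x s) (v s)) (inner ℝ (v t) f) I t := by
  have hp := norm_pos_iff.2 h0
  have hn : HasDerivWithinAt (fun s => ‖x s‖) (inner ℝ (x t) (v t) / ‖x t‖) I t := by
    have h := hx.norm_sq.sqrt (by positivity)
    simp only [Real.sqrt_sq (norm_nonneg _)] at h
    convert h using 1
    field_simp
  unfold keplerEnergy
  refine ((hv.norm_sq.div_const 2).sub
    ((hasDerivWithinAt_const t I (1 : ℝ)).div hn hp.ne')).congr_deriv ?_
  rw [inner_add_right, inner_neg_right, inner_smul_right, real_inner_comm (v t) (x t)]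
  field_simp
  ring

theorem hasDerivWithinAt_keplerAngMom {x v : ℝ → Plane} {f : Plane} {I : Set ℝ} {t c : ℝ}
    (hx : HasDerivWithinAt x (v t) I t)
    (hv : HasDerivWithinAt v (-(c • x t) + f) I t) :
    HasDerivWithinAt (fun s => keplerAngMom (x s) (v s)) (keplerAngMom (x t) f) I t := by
  have hx' := fun i : Fin 2 => hasFDerivWithinAt_euclidean.1 hx i |>.hasDerivWithinAt
  have hv' := fun i : Fin 2 => hasFDerivWithinAt_euclidean.1 hv i |>.hasDerivWithinAt
  unfold keplerAngMom
  refine (((hx' 0).mul (hv' 1)).sub ((hx' 1).mul (hv' 0))).congr_deriv ?_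
  simp
  ring

/-- A central force exerts no torque. -/
theorem keplerAngMom_gradient_radial {V : ℝ → ℝ} {y : Plane}
    (h : DifferentiableAt ℝ (fun z : Plane => V ‖z‖) y) :
    keplerAngMom y (gradient (fun z : Plane => V ‖z‖) y) = 0 := by
  set g := gradient (fun z : Plane => V ‖z‖) y with hg
  -- `V ‖·‖` is constant along the rotations `γ θ` of `y`.
  let γ : ℝ → Plane := fun θ => Real.cos θ • y + Real.sin θ • !₂[-y 1, y 0]
  have hγ0 : γ 0 = y := by simp [γ]
  have hγn : ∀ θ, ‖γ θ‖ = ‖y‖ := by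
    intro θ
    rw [EuclideanSpace.norm_eq, EuclideanSpace.norm_eq]
    congr 1
    simp only [Fin.sum_univ_two, Real.norm_eq_abs, sq_abs, γ]
    simp
    linear_combination (y 0 ^ 2 + y 1 ^ 2) * Real.sin_sq_add_cos_sq θ
  have hγd : HasDerivAt γ !₂[-y 1, y 0] 0 :=
    (((Real.hasDerivAt_cos 0).smul_const y).add
      ((Real.hasDerivAt_sin 0).smul_const _)).congr_deriv (by simp)
  have hgr : HasFDerivAt (fun z : Plane => V ‖z‖) (InnerProductSpace.toDual ℝ Plane g) (γ 0) := by
    rw [hγ0]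
    exact h.hasGradientAt.hasFDerivAt
  have h1 := hgr.comp_hasDerivAt (0 : ℝ) hγd
  have h2 : HasDerivAt ((fun z : Plane => V ‖z‖) ∘ γ) 0 0 := by
    have : ((fun z : Plane => V ‖z‖) ∘ γ) = fun _ => V ‖y‖ := by
      funext θ
      simp [hγn]
    rw [this]
    exact hasDerivAt_const _ _
  have h3 := h1.unique h2
  rw [InnerProductSpace.toDual_apply_apply, PiLp.inner_apply, Fin.sum_univ_two] at h3
  simp at h3
  unfold keplerAngMom
  linarith

theorem eq_of_hasDerivWithinAt_zero {f : ℝ → ℝ} {I : Set ℝ} (hI : Convex ℝ I)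
    (h : ∀ t ∈ I, HasDerivWithinAt f 0 I t) {s t : ℝ} (hs : s ∈ I) (ht : t ∈ I) : f s = f t := by
  have := hI.norm_image_sub_le_of_norm_hasDerivWithin_le (C := 0) h (by simp) ht hs
  simpa [sub_eq_zero] using this

namespace IsMotion

variable {m₁ m₂ : ℝ} {V : ℝ → ℝ} {I : Set ℝ} {x₁ x₂ v₁ v₂ : ℝ → Plane}

theorem hasDerivWithinAt_energy₁ (h : IsMotion m₁ m₂ V I x₁ x₂ v₁ v₂) {t : ℝ} (ht : t ∈ I) :
    HasDerivWithinAt (fun s => keplerEnergy (x₁ s) (v₁ s))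
      (inner ℝ (v₁ t) (-((1 / m₁) • gradient (fun y : Plane => V ‖y‖) (x₁ t - x₂ t)))) I t :=
  hasDerivWithinAt_keplerEnergy (h.ne_center₁ t ht) (h.velocity₁ t ht)
    (by simpa only [sub_eq_add_neg] using h.newton₁ t ht)

theorem hasDerivWithinAt_energy₂ (h : IsMotion m₁ m₂ V I x₁ x₂ v₁ v₂) {t : ℝ} (ht : t ∈ I) :
    HasDerivWithinAt (fun s => keplerEnergy (x₂ s) (v₂ s))
      (inner ℝ (v₂ t) ((1 / m₂) • gradient (fun y : Plane => V ‖y‖) (x₁ t - x₂ t))) I t :=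
  hasDerivWithinAt_keplerEnergy (h.ne_center₂ t ht) (h.velocity₂ t ht) (h.newton₂ t ht)

theorem hasDerivWithinAt_angMom₁ (h : IsMotion m₁ m₂ V I x₁ x₂ v₁ v₂) {t : ℝ} (ht : t ∈ I) :
    HasDerivWithinAt (fun s => keplerAngMom (x₁ s) (v₁ s))
      (keplerAngMom (x₁ t)
        (-((1 / m₁) • gradient (fun y : Plane => V ‖y‖) (x₁ t - x₂ t)))) I t :=
  hasDerivWithinAt_keplerAngMom (h.velocity₁ t ht)
    (by simpa only [sub_eq_add_neg] using h.newton₁ t ht)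

theorem hasDerivWithinAt_angMom₂ (h : IsMotion m₁ m₂ V I x₁ x₂ v₁ v₂) {t : ℝ} (ht : t ∈ I) :
    HasDerivWithinAt (fun s => keplerAngMom (x₂ s) (v₂ s))
      (keplerAngMom (x₂ t) ((1 / m₂) • gradient (fun y : Plane => V ‖y‖) (x₁ t - x₂ t))) I t :=
  hasDerivWithinAt_keplerAngMom (h.velocity₂ t ht) (h.newton₂ t ht)

theorem systemEnergy_eq (h : IsMotion m₁ m₂ V I x₁ x₂ v₁ v₂) (hm₁ : m₁ ≠ 0) (hm₂ : m₂ ≠ 0)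
    {s t : ℝ} (hs : s ∈ I) (ht : t ∈ I) :
    systemEnergy m₁ m₂ V (x₁ s) (x₂ s) (v₁ s) (v₂ s)
      = systemEnergy m₁ m₂ V (x₁ t) (x₂ t) (v₁ t) (v₂ t) := by
  refine eq_of_hasDerivWithinAt_zero
    (f := fun s => systemEnergy m₁ m₂ V (x₁ s) (x₂ s) (v₁ s) (v₂ s))
    h.interval.convex (fun t ht => ?_) hs ht
  have hV : HasDerivWithinAt (fun s => V ‖x₁ s - x₂ s‖)
      (inner ℝ (gradient (fun y : Plane => V ‖y‖) (x₁ t - x₂ t)) (v₁ t - v₂ t)) I t :=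
    (h.differentiableAt t ht).hasGradientAt.hasFDerivAt.comp_hasDerivWithinAt (f := x₁ - x₂) t
      ((h.velocity₁ t ht).sub (h.velocity₂ t ht))
  unfold systemEnergy
  refine (((((h.hasDerivWithinAt_energy₁ ht).const_mul m₁).add
    ((h.hasDerivWithinAt_energy₂ ht).const_mul m₂)).add hV).div_const (m₁ + m₂)).congr_deriv ?_
  rw [inner_neg_right, inner_smul_right, inner_smul_right, inner_sub_right,
    real_inner_comm (v₁ t), real_inner_comm (v₂ t)]
  field_simp
  ring

theorem systemAngMom_eq (h : IsMotion m₁ m₂ V I x₁ x₂ v₁ v₂) (hm₁ : m₁ ≠ 0) (hm₂ : m₂ ≠ 0)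
    {s t : ℝ} (hs : s ∈ I) (ht : t ∈ I) :
    systemAngMom m₁ m₂ (x₁ s) (x₂ s) (v₁ s) (v₂ s)
      = systemAngMom m₁ m₂ (x₁ t) (x₂ t) (v₁ t) (v₂ t) := by
  refine eq_of_hasDerivWithinAt_zero
    (f := fun s => systemAngMom m₁ m₂ (x₁ s) (x₂ s) (v₁ s) (v₂ s))
    h.interval.convex (fun t ht => ?_) hs ht
  have hg := keplerAngMom_gradient_radial (h.differentiableAt t ht)
  unfold systemAngMom
  refine ((((h.hasDerivWithinAt_angMom₁ ht).const_mul m₁).add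
    ((h.hasDerivWithinAt_angMom₂ ht).const_mul m₂)).div_const (m₁ + m₂)).congr_deriv ?_
  unfold keplerAngMom at hg ⊢
  simp only [PiLp.sub_apply, PiLp.neg_apply, PiLp.smul_apply, smul_eq_mul] at hg ⊢
  rw [div_eq_zero_iff]
  left
  field_simp
  linarith

/-- While the particles are out of the range of their interaction, both osculating orbits are fixed. -/
theorem eventually_free (h : IsMotion m₁ m₂ V I x₁ x₂ v₁ v₂) {D : ℝ}
    (hV : ∀ r, D ≤ r → V r = 0) {t : ℝ} (ht : t ∈ I) (hd : D < ‖x₁ t - x₂ t‖) :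
    ∀ᶠ s in 𝓝[I] t, keplerEnergy (x₁ s) (v₁ s) = keplerEnergy (x₁ t) (v₁ t) ∧
      keplerEnergy (x₂ s) (v₂ s) = keplerEnergy (x₂ t) (v₂ t) ∧
      keplerAngMom (x₁ s) (v₁ s) = keplerAngMom (x₁ t) (v₁ t) ∧
      keplerAngMom (x₂ s) (v₂ s) = keplerAngMom (x₂ t) (v₂ t) := by
  have hc : ContinuousWithinAt (fun s => ‖x₁ s - x₂ s‖) I t :=
    ((h.velocity₁ t ht).continuousWithinAt.sub (h.velocity₂ t ht).continuousWithinAt).norm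
  obtain ⟨r, hr, hball⟩ := Metric.mem_nhdsWithin_iff.1 (hc.eventually (lt_mem_nhds hd))
  have hconv : Convex ℝ (Metric.ball t r ∩ I) := (convex_ball t r).inter h.interval.convex
  have htB : t ∈ Metric.ball t r ∩ I := ⟨Metric.mem_ball_self hr, ht⟩
  have hgrad : ∀ s ∈ Metric.ball t r ∩ I,
      gradient (fun y : Plane => V ‖y‖) (x₁ s - x₂ s) = 0 := by
    intro s hs
    have hev : (fun y : Plane => V ‖y‖) =ᶠ[𝓝 (x₁ s - x₂ s)] fun _ => 0 := by
      filter_upwards [continuous_norm.continuousAt.eventually (lt_mem_nhds (hball hs))] with y hy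
      exact hV _ hy.le
    have h0 : HasGradientAt (fun _ : Plane => (0 : ℝ)) 0 (x₁ s - x₂ s) := hasGradientAt_const _ _
    exact (h0.congr_of_eventuallyEq hev).gradient
  have hsub : Metric.ball t r ∩ I ⊆ I := Set.inter_subset_right
  filter_upwards [inter_mem_nhdsWithin I (Metric.ball_mem_nhds t hr)] with s hs
  have hs : s ∈ Metric.ball t r ∩ I := ⟨hs.2, hs.1⟩
  refine ⟨eq_of_hasDerivWithinAt_zero (f := fun s => keplerEnergy (x₁ s) (v₁ s)) hconv
      (fun u hu => ?_) hs htB,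
    eq_of_hasDerivWithinAt_zero (f := fun s => keplerEnergy (x₂ s) (v₂ s)) hconv
      (fun u hu => ?_) hs htB,
    eq_of_hasDerivWithinAt_zero (f := fun s => keplerAngMom (x₁ s) (v₁ s)) hconv
      (fun u hu => ?_) hs htB,
    eq_of_hasDerivWithinAt_zero (f := fun s => keplerAngMom (x₂ s) (v₂ s)) hconv
      (fun u hu => ?_) hs htB⟩
  · simpa [hgrad u hu] using (h.hasDerivWithinAt_energy₁ hu.2).mono hsub
  · simpa [hgrad u hu] using (h.hasDerivWithinAt_energy₂ hu.2).mono hsub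
  · simpa [hgrad u hu, keplerAngMom] using (h.hasDerivWithinAt_angMom₁ hu.2).mono hsub
  · simpa [hgrad u hu, keplerAngMom] using (h.hasDerivWithinAt_angMom₂ hu.2).mono hsub

end IsMotion

/-- The lower bound on `V` is only given at positive distances; at a coincidence of the particles it
follows from the continuity of `V ‖·‖`. -/
theorem neg_le_potential_of_differentiableAt {V : ℝ → ℝ} {U : ℝ} (hV : ∀ r, 0 < r → -U ≤ V r)
    {y : Plane} (h : DifferentiableAt ℝ (fun z : Plane => V ‖z‖) y) : -U ≤ V ‖y‖ := by
  have hc : Tendsto (fun z : Plane => V ‖z‖) (𝓝[≠] y) (𝓝 (V ‖y‖)) :=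
    h.continuousAt.tendsto.mono_left nhdsWithin_le_nhds
  rcases eq_or_ne y 0 with rfl | hy
  · refine ge_of_tendsto hc ?_
    filter_upwards [self_mem_nhdsWithin] with z hz
    exact hV _ (norm_pos_iff.2 hz)
  · exact hV _ (norm_pos_iff.2 hy)

/-! ### Continuation along the time interval -/

/-- A property that is open and closed relative to an interval holds on all of it. -/
theorem forall_mem_of_isOpen_isClosed {I : Set ℝ} (hI : I.OrdConnected) {P : ℝ → Prop} {t₀ : ℝ}
    (ht₀ : t₀ ∈ I) (h₀ : P t₀) (hopen : ∀ t ∈ I, P t → ∀ᶠ s in 𝓝[I] t, P s)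
    (hclosed : ∀ t ∈ I, (∃ᶠ s in 𝓝[I] t, P s) → P t) : ∀ t ∈ I, P t := by
  have : PreconnectedSpace I := Subtype.preconnectedSpace hI.isPreconnected
  have hev : ∀ (Q : ℝ → Prop) (t : I), (∀ᶠ s in 𝓝[I] (t : ℝ), Q s) ↔ ∀ᶠ s : I in 𝓝 t, Q s := by
    intro Q t
    rw [nhdsWithin_eq_map_subtype_coe t.2, eventually_map]
  have hclopen : IsClopen {t : I | P t} := by
    refine ⟨isClosed_iff_frequently.2 fun t ht => hclosed t t.2 ?_,
      isOpen_iff_mem_nhds.2 fun t ht => (hev P t).1 (hopen t t.2 ht)⟩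
    intro hn
    exact ht ((hev _ t).1 hn)
  have := hclopen.eq_univ ⟨⟨t₀, ht₀⟩, h₀⟩
  intro t ht
  have : (⟨t, ht⟩ : I) ∈ {t : I | P t} := this ▸ Set.mem_univ _
  exact this

/-! ### Bounds on a single orbit, and the conclusion -/

theorem norm_le_of_keplerEnergy_le {x v : Plane} {δ : ℝ} (hδ : 0 < δ) (hx : x ≠ 0)
    (h : keplerEnergy x v ≤ -δ) : ‖x‖ ≤ 1 / δ := by
  have := neg_inv_norm_le_keplerEnergy x v
  rw [le_one_div (norm_pos_iff.2 hx) hδ]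
  linarith

theorem abs_keplerAngMom_le_of_keplerEnergy_le {x v : Plane} {δ : ℝ} (hδ : 0 < δ) (hx : x ≠ 0)
    (h : keplerEnergy x v ≤ -δ) : |keplerAngMom x v| ≤ Real.sqrt (2 / δ) := by
  refine Real.abs_le_sqrt ?_
  have h1 := norm_le_of_keplerEnergy_le hδ hx h
  have h2 : 2 / δ = 2 * (1 / δ) := by ring
  nlinarith [keplerAngMom_sq_le x v, norm_sq_mul_norm_le hx (h.trans (by linarith)),
    norm_nonneg x]

theorem keplerEcc_le {x v : Plane} {δ : ℝ} (hδ : 0 < δ) (h : keplerEnergy x v ≤ -δ)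
    (hl : δ ≤ |keplerAngMom x v|) : keplerEcc x v ≤ Real.sqrt (1 - 2 * δ * δ ^ 2) := by
  refine Real.sqrt_le_sqrt ?_
  have h1 : δ ^ 2 ≤ keplerAngMom x v ^ 2 := by
    rw [← sq_abs (keplerAngMom x v)]
    exact pow_le_pow_left₀ hδ.le hl 2
  nlinarith [sq_nonneg δ]

theorem theorem4 (m₁ m₂ E L : ℝ) (hm₁ : 0 < m₁) (hm₁₂ : m₁ ≤ m₂)
    (hEL : E * L ^ 2 < sigmaCrit (m₁ / (m₁ + m₂)) (m₂ / (m₁ + m₂))) :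
    ∃ D₀ U₀ R Λ c₁ c₂ : ℝ, 0 < D₀ ∧ 0 < U₀ ∧ c₁ < 1 ∧ c₂ < 1 ∧
      ∀ (D U : ℝ) (V : ℝ → ℝ), 0 < D → D ≤ D₀ → 0 ≤ U → U ≤ U₀ →
        (∀ r, D ≤ r → V r = 0) → (∀ r, 0 < r → -U ≤ V r) →
        ∀ (I : Set ℝ) (x₁ x₂ v₁ v₂ : ℝ → Plane) (t₀ : ℝ),
          IsMotion m₁ m₂ V I x₁ x₂ v₁ v₂ → t₀ ∈ I →
          systemEnergy m₁ m₂ V (x₁ t₀) (x₂ t₀) (v₁ t₀) (v₂ t₀) = E →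
          systemAngMom m₁ m₂ (x₁ t₀) (x₂ t₀) (v₁ t₀) (v₂ t₀) = L →
          keplerEnergy (x₁ t₀) (v₁ t₀) < 0 → keplerEnergy (x₂ t₀) (v₂ t₀) < 0 →
          (∀ t ∈ I, keplerEnergy (x₁ t) (v₁ t) < 0 ∧ keplerEnergy (x₂ t) (v₂ t) < 0) ∧
          (∃ ρ : ℝ, ∀ t ∈ I, ‖x₁ t‖ ≤ ρ ∧ ‖x₂ t‖ ≤ ρ) ∧
          ((∃ s ∈ I, ‖x₁ s - x₂ s‖ ≤ D) → ∀ t ∈ I,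
            ‖x₁ t‖ ≤ R ∧ ‖x₂ t‖ ≤ R ∧
            |keplerAngMom (x₁ t) (v₁ t)| ≤ Λ ∧ |keplerAngMom (x₂ t) (v₂ t)| ≤ Λ ∧
            keplerEcc (x₁ t) (v₁ t) ≤ c₁ ∧ keplerEcc (x₂ t) (v₂ t) ≤ c₂) := by
  have hm₂ : 0 < m₂ := hm₁.trans_le hm₁₂
  have hM : 0 < m₁ + m₂ := add_pos hm₁ hm₂
  obtain ⟨ε, hε, hmargin⟩ := exists_uniform_margin (div_pos hm₁ hM)
    (div_le_div_of_nonneg_right hm₁₂ hM.le) (by rw [← add_div, div_self hM.ne']) hEL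
  have hc : Real.sqrt (1 - 2 * ε * ε ^ 2) < 1 := by
    rw [Real.sqrt_lt' one_pos]
    nlinarith [mul_pos hε (pow_pos hε 2)]
  -- `sqrt (1 - 2 * ε ^ 3)` is below `1` also if the radicand is negative, as it is `0` then.
  refine ⟨ε / 2, (m₁ + m₂) * ε, 1 / ε, Real.sqrt (2 / ε), _, _, half_pos hε, mul_pos hM hε,
    hc, hc, ?_⟩
  intro D U V _ hD _ hU hV0 hVU I x₁ x₂ v₁ v₂ t₀ hmot ht₀ hE hL he₁ he₂
  let E₁ := fun t => keplerEnergy (x₁ t) (v₁ t)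
  let E₂ := fun t => keplerEnergy (x₂ t) (v₂ t)
  let L₁ := fun t => keplerAngMom (x₁ t) (v₁ t)
  let L₂ := fun t => keplerAngMom (x₂ t) (v₂ t)
  have cE₁ : ∀ t ∈ I, ContinuousWithinAt E₁ I t := fun t ht =>
    (hmot.hasDerivWithinAt_energy₁ ht).continuousWithinAt
  have cE₂ : ∀ t ∈ I, ContinuousWithinAt E₂ I t := fun t ht =>
    (hmot.hasDerivWithinAt_energy₂ ht).continuousWithinAt
  have cL₁ : ∀ t ∈ I, ContinuousWithinAt L₁ I t := fun t ht =>
    (hmot.hasDerivWithinAt_angMom₁ ht).continuousWithinAt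
  have cL₂ : ∀ t ∈ I, ContinuousWithinAt L₂ I t := fun t ht =>
    (hmot.hasDerivWithinAt_angMom₂ ht).continuousWithinAt
  have cd : ∀ t ∈ I, ContinuousWithinAt (fun s => ‖x₁ s - x₂ s‖) I t := fun t ht =>
    ((hmot.velocity₁ t ht).continuousWithinAt.sub (hmot.velocity₂ t ht).continuousWithinAt).norm
  have free := fun {t} (ht : t ∈ I) hd => hmot.eventually_free hV0 ht hd
  have hclose : ∀ t ∈ I, E₁ t ≤ 0 → E₂ t ≤ 0 → ‖x₁ t - x₂ t‖ ≤ ε →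
      (E₁ t ≤ -ε ∧ E₂ t ≤ -ε) ∧ ε ≤ |L₁ t| ∧ ε ≤ |L₂ t| := by
    intro t ht h₁ h₂ hd
    refine hmargin _ _ _ _ (hmot.ne_center₁ t ht) (hmot.ne_center₂ t ht) h₁ h₂ hd ?_ ?_
    · have hEt := (hmot.systemEnergy_eq hm₁.ne' hm₂.ne' ht ht₀).trans hE
      have hVt := neg_le_potential_of_differentiableAt hVU (hmot.differentiableAt t ht)
      have : -ε ≤ V ‖x₁ t - x₂ t‖ / (m₁ + m₂) := by
        rw [le_div_iff₀ hM]
        linarith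
      rw [← hEt, systemEnergy, add_div, add_div, mul_div_right_comm, mul_div_right_comm]
      linarith
    · rw [← (hmot.systemAngMom_eq hm₁.ne' hm₂.ne' ht ht₀).trans hL, systemAngMom, add_div,
        mul_div_right_comm, mul_div_right_comm]
  -- An orbit cannot become parabolic: away from the interaction it does not change, and during the
  -- interaction `hclose` applies already to parabolic orbits.
  have hell : ∀ t ∈ I, E₁ t < 0 ∧ E₂ t < 0 := by
    refine forall_mem_of_isOpen_isClosed hmot.interval ht₀ ⟨he₁, he₂⟩ ?_ ?_
    · rintro t ht ⟨h₁, h₂⟩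
      exact ((cE₁ t ht).eventually (gt_mem_nhds h₁)).and ((cE₂ t ht).eventually (gt_mem_nhds h₂))
    · intro t ht hf
      rcases lt_or_ge D ‖x₁ t - x₂ t‖ with hd | hd
      · obtain ⟨s, ⟨h₁, h₂⟩, f₁, f₂, -⟩ := (hf.and_eventually (free ht hd)).exists
        exact ⟨f₁.symm.trans_lt h₁, f₂.symm.trans_lt h₂⟩
      · obtain ⟨⟨k₁, k₂⟩, -⟩ := hclose t ht
          (le_of_tendsto_of_frequently (cE₁ t ht) (hf.mono fun s hs => hs.1.le))
          (le_of_tendsto_of_frequently (cE₂ t ht) (hf.mono fun s hs => hs.2.le)) (by linarith)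
        exact ⟨by linarith, by linarith⟩
  -- Since `D ≤ ε / 2`, `hclose` also applies shortly before and after an interaction; hence the
  -- margins of `hclose` are an open condition at interaction times.
  have hinter : (∃ s ∈ I, ‖x₁ s - x₂ s‖ ≤ D) →
      ∀ t ∈ I, (E₁ t ≤ -ε ∧ E₂ t ≤ -ε) ∧ ε ≤ |L₁ t| ∧ ε ≤ |L₂ t| := by
    rintro ⟨s, hs, hsD⟩
    refine forall_mem_of_isOpen_isClosed hmot.interval hs
      (hclose s hs (hell s hs).1.le (hell s hs).2.le (by linarith)) ?_ ?_
    · intro t ht hP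
      rcases lt_or_ge D ‖x₁ t - x₂ t‖ with hd | hd
      · filter_upwards [free ht hd] with s ⟨f₁, f₂, f₃, f₄⟩
        simpa only [E₁, E₂, L₁, L₂, f₁, f₂, f₃, f₄] using hP
      · filter_upwards [(cd t ht).eventually (gt_mem_nhds (show ‖x₁ t - x₂ t‖ < ε by linarith)),
          self_mem_nhdsWithin] with s hs hsI
        exact hclose s hsI (hell s hsI).1.le (hell s hsI).2.le hs.le
    · intro t ht hf
      exact ⟨⟨le_of_tendsto_of_frequently (cE₁ t ht) (hf.mono fun s hs => hs.1.1),
        le_of_tendsto_of_frequently (cE₂ t ht) (hf.mono fun s hs => hs.1.2)⟩,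
        ge_of_tendsto_of_frequently (cL₁ t ht).abs (hf.mono fun s hs => hs.2.1),
        ge_of_tendsto_of_frequently (cL₂ t ht).abs (hf.mono fun s hs => hs.2.2)⟩
  refine ⟨hell, ?_, ?_⟩
  · by_cases hex : ∃ s ∈ I, ‖x₁ s - x₂ s‖ ≤ D
    · exact ⟨1 / ε, fun t ht =>
        ⟨norm_le_of_keplerEnergy_le hε (hmot.ne_center₁ t ht) (hinter hex t ht).1.1,
        norm_le_of_keplerEnergy_le hε (hmot.ne_center₂ t ht) (hinter hex t ht).1.2⟩⟩
    · push Not at hex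
      have hconst : ∀ t ∈ I, E₁ t = E₁ t₀ ∧ E₂ t = E₂ t₀ := by
        refine forall_mem_of_isOpen_isClosed hmot.interval ht₀ ⟨rfl, rfl⟩ ?_ ?_
        · rintro t ht ⟨h₁, h₂⟩
          filter_upwards [free ht (hex t ht)] with s ⟨f₁, f₂, _⟩
          exact ⟨f₁.trans h₁, f₂.trans h₂⟩
        · intro t ht hf
          obtain ⟨s, ⟨h₁, h₂⟩, f₁, f₂, -⟩ := (hf.and_eventually (free ht (hex t ht))).exists
          exact ⟨f₁.symm.trans h₁, f₂.symm.trans h₂⟩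
      refine ⟨max (1 / -E₁ t₀) (1 / -E₂ t₀), fun t ht => ⟨le_max_of_le_left ?_,
        le_max_of_le_right ?_⟩⟩
      · exact norm_le_of_keplerEnergy_le (neg_pos.2 he₁) (hmot.ne_center₁ t ht)
          (by rw [neg_neg]; exact (hconst t ht).1.le)
      · exact norm_le_of_keplerEnergy_le (neg_pos.2 he₂) (hmot.ne_center₂ t ht)
          (by rw [neg_neg]; exact (hconst t ht).2.le)
  · intro hex t ht
    obtain ⟨⟨k₁, k₂⟩, l₁, l₂⟩ := hinter hex t ht
    have n₁ := hmot.ne_center₁ t ht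
    have n₂ := hmot.ne_center₂ t ht
    exact ⟨norm_le_of_keplerEnergy_le hε n₁ k₁, norm_le_of_keplerEnergy_le hε n₂ k₂,
      abs_keplerAngMom_le_of_keplerEnergy_le hε n₁ k₁,
      abs_keplerAngMom_le_of_keplerEnergy_le hε n₂ k₂, keplerEcc_le hε k₁ l₁, keplerEcc_le hε k₂ l₂⟩
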